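/- **Setting.** Let $R$ be a Noetherian local ring with infinite residue field $k$, and let $N$ be a finitely generated $R$-module. For a prime $P$ of $R$ let $\mu_P(M)$ denote the minimal number of generators of the $R_P$-module $M_P$, and $rf_P(M)$ the maximal rank of a free direct summand of $M_P$; put $\mu(M)=\mu_{\mathfrak m}(M)$, where $\mathfrak m$ is the maximal ideal. Write $(-)^*=\operatorname{Hom}_R(-,R)$. For $x\in N$ the order ideal is $N^*(x)=\{f(x)\mid f\in N^*\}$; the unit ideal has height $\infty$. If $x_1,\dots,x_n$ is a minimal generating set of $N$ and $\pi:R^n\to N$ sends $e_i$ to $x_i$, put $N^\perp=\operatorname{Coker}(\pi^*)$ (up to isomorphism this depends only on $N$). The Rees algebra of a finitely generated $R$-module $M$ is $\mathcal R(M)=\operatorname{Sym}(M)/\bigcap_g\ker(\operatorname{Sym}(g))$, where $g$ ranges over all $R$-linear maps from $M$ to free $R$-modules, and the analytic spread of $M$ is $\ell(M)=\dim(k\otimes_R\mathcal R(M))$. The module $M$ satisfies $G_s$ (for a positive integer $s$) if there is $e$ such that $M_Q$ is free of rank $e$ for every minimal prime $Q$ of $R$ and $\mu_Q(M)\le\dim(R_Q)+e-1$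 for every prime $Q$ with $1\le\dim(R_Q)\le s-1$; it satisfies $G_\infty$ if it satisfies $G_s$ for every $s\geq 1$. **Proposition.** Let $r\ge 0$ be an integer, and consider the condition $(\ast)$ $\; rf_P(N)\ge r+1-\dim(R_P)$ for every prime $P$ of $R$ such that $N_P$ is not free. 1. If $(\ast)$ holds and $\operatorname{ht}(N^*(x))\le r$ for every $x\in N$, then $\ell(N^\perp)=\mu(N)$. 2. If $N_Q$ is free of rank $r$ for every minimal prime $Q$ of $R$ and $N^\perp$ satisfies $G_\infty$, then $(\ast)$ holds. 3. Consequently, if $N_Q$ is free of rank $r$ for every minimal prime $Q$ of $R$, $N^\perp$ satisfies $G_\infty$, and $\operatorname{ht}(N^*(x))\le r$ for every $x\in N$, then $\ell(N^\perp)=\mu(N)$. -/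

import Mathlib

open scoped TensorProduct

universe u v w

noncomputable section

namespace OrderIdeals

/-- `μ(M)`, the minimal number of generators of a finitely generated module. -/
def minGens (A : Type u) (M : Type v) [CommRing A] [AddCommGroup M] [Module A M] : ℕ :=
  (⊤ : Submodule A M).spanFinrank

/-- The maximal rank of a free direct summand of a finitely generated module `M`. A free
direct summand of rank `k` is given by a split injection `A ^ k → M`. -/
def freeSummandRank (A : Type u) (M : Type v) [CommRing A] [AddCommGroup M] [Module A M] : ℕ :=
  sSup {k : ℕ | ∃ (i : (Fin k → A) →ₗ[A] M) (p : M →ₗ[A] (Fin k → A)), p ∘ₗ i = LinearMap.id}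

section

variable (R : Type u) (M : Type v) [CommRing R] [AddCommGroup M] [Module R M]

/-- `μ_P(M)`, the minimal number of generators of `M_P` over `R_P`. -/
def minGensAt (P : PrimeSpectrum R) : ℕ :=
  minGens (Localization.AtPrime P.asIdeal) (LocalizedModule P.asIdeal.primeCompl M)

/-- `rf_P(M)`, the maximal rank of an `R_P`-free direct summand of `M_P`. -/
def rf (P : PrimeSpectrum R) : ℕ :=
  freeSummandRank (Localization.AtPrime P.asIdeal) (LocalizedModule P.asIdeal.primeCompl M)

/-- `dim(R_P)`. -/
def localDim (P : PrimeSpectrum R) : WithBot ℕ∞ :=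
  ringKrullDim (Localization.AtPrime P.asIdeal)

/-- `M_Q` is free of rank `r` for every minimal prime `Q` of `R`. -/
def HasGenericRank (r : ℕ) : Prop :=
  ∀ Q : PrimeSpectrum R, Q.asIdeal ∈ minimalPrimes R →
    Module.Free (Localization.AtPrime Q.asIdeal) (LocalizedModule Q.asIdeal.primeCompl M) ∧
    Module.finrank (Localization.AtPrime Q.asIdeal)
      (LocalizedModule Q.asIdeal.primeCompl M) = r

/-- The condition `G_s`: `M` is free of constant rank `e` at the minimal primes, and
`μ_Q(M) ≤ dim(R_Q) + e - 1` for every prime `Q` with `1 ≤ dim(R_Q) ≤ s - 1`. -/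
def SatisfiesG (s : ℕ) : Prop :=
  ∃ e : ℕ, HasGenericRank R M e ∧
    ∀ Q : PrimeSpectrum R, 1 ≤ localDim R Q → localDim R Q + 1 ≤ (s : WithBot ℕ∞) →
      (minGensAt R M Q : WithBot ℕ∞) + 1 ≤ localDim R Q + (e : WithBot ℕ∞)

/-- The condition `G_∞`: `G_s` holds for every positive integer `s`. -/
def SatisfiesGInfty : Prop :=
  ∀ s : ℕ, 0 < s → SatisfiesG R M s

variable {M}

/-- The order ideal `N^*(x) = {f(x) | f ∈ N^*}`. -/
def orderIdeal (x : M) : Ideal R :=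
  LinearMap.range (Module.Dual.eval R M x)

/-- `[x_1, …, x_n]^⊥ = Coker(π^*)`, where `π : R ^ n → N` sends `e_i` to `x_i`. If `R` is local
and the `x_i` are minimal generators of `N`, this is the perpendicular module `N^⊥`. -/
abbrev Perp {n : ℕ} (x : Fin n → M) : Type u :=
  Module.Dual R (Fin n → R) ⧸ LinearMap.range (Fintype.linearCombination R x).dualMap

variable {R}

/-- `Sym(g) : Sym(M) → Sym(G)`. -/
def symMap {G : Type w} [AddCommGroup G] [Module R G] (g : M →ₗ[R] G) :
    SymmetricAlgebra R M →ₐ[R] SymmetricAlgebra R G :=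
  SymmetricAlgebra.lift (SymmetricAlgebra.ι R G ∘ₗ g)

variable (R M)

/-- The intersection of the kernels of `Sym(g)` over all maps `g` from `M` to free modules. -/
def reesIdeal : Ideal (SymmetricAlgebra R M) :=
  ⨅ (G : Type u) (_ : AddCommGroup G) (_ : Module R G) (_ : Module.Free R G)
    (g : M →ₗ[R] G), RingHom.ker (symMap g)

/-- The Rees algebra of a module. -/
abbrev ReesAlgebra : Type (max u v) :=
  SymmetricAlgebra R M ⧸ reesIdeal R M

/-- The analytic spread `ℓ(M)`: the Krull dimension of `k ⊗ Rees(M)`, `k` the residue field. -/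
def analyticSpread [IsLocalRing R] : WithBot ℕ∞ :=
  ringKrullDim (IsLocalRing.ResidueField R ⊗[R] ReesAlgebra R M)

/-- `rf_P(M) ≥ r + 1 - dim(R_P)` for every prime `P` in the nonfree locus of `M`. -/
def LargeFreeSummands (r : ℕ) : Prop :=
  ∀ P : PrimeSpectrum R, P ∉ Module.freeLocus R M →
    (r : WithBot ℕ∞) + 1 ≤ (rf R M P : WithBot ℕ∞) + localDim R P

end

end OrderIdeals

end

/-! For the first statement, suppose that some polynomial `F` in `n = μ(N)` variables maps into the
Rees ideal of `N^⊥` but is nonzero modulo the maximal ideal. Let `J` define the nonfree locus of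
`N`, and let `I` be generated by `J` and the linear forms `∑ f(x_i) X_i` with `f ∈ N^*`. A prime
containing `I` lies over some nonfree `P` and contains `rf_P(N)` forms independent over `κ(P)`, so
by `(∗)` its height is at least `r + 1`. As the residue field is infinite, the variables can be
specialized to some `a` with `F(a)` a unit and `I(a)` still of height at least `r + 1`. Put `y = ∑
a_i x_i`. A prime `P ⊇ N^*(y)` with `N_P` free would contain `F(a)`, since then `a` agrees modulo
`P`, up to a unit, with a relation on the generators, and relations are functionals on `N^⊥`. So
every prime containing `N^*(y)` also contains `J`, hence `I(a)`, and `ht N^*(y) ≥ r + 1`, a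
contradiction. Thus `k ⊗ Rees(N^⊥)` is a polynomial ring in `n` variables.

The second statement compares ranks: `n ≤ μ_P(N^⊥) + rf_P(N)` at every `P`, while `e + r ≤ n` at a
minimal prime, `e` being the generic rank of `N^⊥`. The bound `μ_P(N^⊥) ≤ dim R_P + e - 1` then
gives `(∗)`.

The main lemmas are `MvPolynomial.exists_eval_isUnit_and_le_height`,
`MvPolynomial.height_add_le_height`, `eval_mem_of_mem_reesIdeal` and `le_minGensAt_perp_add_rf`. -/

namespace Ideal

/-! ### Heights under specialization of variables -/

theorem le_height_iff_forall_isPrime {A : Type*} [CommRing A] {I : Ideal A} {s : ℕ∞} :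
    s ≤ I.height ↔ ∀ P : Ideal A, P.IsPrime → I ≤ P → s ≤ P.height := by
  refine ⟨fun h P _ hP ↦ h.trans (height_mono hP), fun h ↦ ?_⟩
  rw [height_eq_inf_minimalPrimes]
  exact le_iInf₂ fun P hP ↦ h P hP.isPrime hP.1.2

theorem height_comap_le_of_ker_eq_span {A B : Type*} [CommRing A] [CommRing B] [IsNoetherianRing B]
    (f : B →+* A) (hf : Function.Surjective f) {b : B} (hb : RingHom.ker f = span {b})
    (P : Ideal A) [P.IsPrime] : (P.comap f).height ≤ P.height + 1 := by
  have hmem : b ∈ P.comap f := by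
    have : b ∈ RingHom.ker f := hb ▸ mem_span_singleton_self b
    rw [mem_comap, (RingHom.mem_ker).1 this]
    exact P.zero_mem
  refine (height_le_height_add_one_of_mem hmem).trans ?_
  gcongr
  rw [← hb, ← RingEquiv.height_map (RingHom.quotientKerEquivOfSurjective hf)]
  apply le_of_eq
  congr 1
  conv_rhs => rw [← map_comap_of_surjective _ hf P]
  exact Ideal.map_map (Quotient.mk _)
    ((RingHom.quotientKerEquivOfSurjective hf : B ⧸ RingHom.ker f →+* A))

theorem height_comap_eval_le {A : Type*} [CommRing A] [IsNoetherianRing A] (a : A) (P : Ideal A)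
    [P.IsPrime] : (P.comap (Polynomial.evalRingHom a)).height ≤ P.height + 1 :=
  height_comap_le_of_ker_eq_span _ (fun b ↦ ⟨Polynomial.C b, by simp⟩)
    (Polynomial.ker_evalRingHom a) P

/-- The preimage of a prime containing the specialized ideal contains `X - a`, so it strictly
contains a minimal prime of `I`. The strict inclusion gains one in height, and evaluation loses at
most one. -/
theorem le_height_map_evalRingHom {A : Type*} [CommRing A] [IsNoetherianRing A]
    {I : Ideal (Polynomial A)} {s : ℕ∞} (hs : s ≤ I.height) (a : A)
    (ha : ∀ Q ∈ I.minimalPrimes, Polynomial.X - Polynomial.C a ∉ Q) :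
    s ≤ (I.map (Polynomial.evalRingHom a)).height := by
  rw [le_height_iff_forall_isPrime]
  intro P hP hIP
  rw [map_le_iff_le_comap] at hIP
  obtain ⟨Q, hQ, hQP⟩ := exists_minimalPrimes_le hIP
  have := hQ.isPrime
  have hlt : Q < P.comap (Polynomial.evalRingHom a) := by
    refine lt_of_le_of_ne hQP fun h ↦ ha Q hQ ?_
    rw [h]
    simp
  have h1 := (height_add_one_le_of_lt_of_isPrime hlt).trans (height_comap_eval_le a P)
  have h2 : s ≤ Q.height := le_height_iff_forall_isPrime.1 hs Q this hQ.1.2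
  exact h2.trans ((ENat.add_le_add_iff_right (by simp)).1 h1)

end Ideal

open IsLocalRing in
/-- Over a local ring with infinite residue field, an ideal of a polynomial ring can be specialized
at a point outside a given hypersurface of the closed fibre without decreasing its height. -/
theorem MvPolynomial.exists_eval_isUnit_and_le_height {R : Type*} [CommRing R] [IsNoetherianRing R]
    [IsLocalRing R] [Infinite (ResidueField R)] {s : ℕ∞} (n : ℕ)
    (I : Ideal (MvPolynomial (Fin n) R)) (hI : s ≤ I.height)
    (F : MvPolynomial (Fin n) R) (hF : map (residue R) F ≠ 0) :
    ∃ a : Fin n → R, IsUnit (eval a F) ∧ s ≤ (I.map (eval a)).height := by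
  induction n with
  | zero =>
    refine ⟨0, ?_, ?_⟩
    · by_contra h
      apply hF
      rw [← mem_nonunits_iff, ← mem_maximalIdeal, ← residue_eq_zero_iff] at h
      obtain ⟨c, rfl⟩ := C_surjective (Fin 0) F
      simpa using h
    · have : eval (0 : Fin 0 → R) = (isEmptyRingEquiv R (Fin 0) : _ →+* R) := by
        apply ringHom_ext
        · intro r
          exact (eval_C r).trans (coeff_zero_C r).symm
        · exact fun i ↦ i.elim0
      rw [this]
      refine hI.trans (le_of_eq (RingEquiv.height_map (isEmptyRingEquiv R (Fin 0)) I).symm)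
  | succ n ih =>
    let e := finSuccEquiv R n
    let J := I.map (e : MvPolynomial (Fin (n + 1)) R →+* Polynomial (MvPolynomial (Fin n) R))
    have hJ : s ≤ J.height := hI.trans (le_of_eq (RingEquiv.height_map e.toRingEquiv I).symm)
    let g := Polynomial.map (map (residue R)) (e F)
    have hg : g ≠ 0 := by
      intro h
      apply hF
      apply (finSuccEquiv (ResidueField R) n).injective
      rw [map_zero, ← h]
      have : ((finSuccEquiv (ResidueField R) n : MvPolynomial (Fin (n + 1)) (ResidueField R) →+* _).comp (map (residue R))) =
          (Polynomial.mapRingHom (map (residue R))).comp (finSuccEquiv R n : MvPolynomial (Fin (n + 1)) R →+*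
            Polynomial (MvPolynomial (Fin n) R)) := by
        apply ringHom_ext
        · intro r; simp [finSuccEquiv_apply]
        · intro i
          refine Fin.cases ?_ (fun j ↦ ?_) i <;> simp [finSuccEquiv_apply]
      exact congr($this F)
    -- Residue classes to avoid in the first variable: those at which `F` dies on the closed fibre.
    have hfin1 : {c : ResidueField R | Polynomial.IsRoot g (C c)}.Finite :=
      (Polynomial.finite_setOfPred_isRoot hg).preimage (C_injective _ _).injOn
    -- Each minimal prime of `J` excludes at most one class: two distinct ones would put the unit
    -- `b' - b` into it.
    have hfin2 : {c : ResidueField R | ∃ Q ∈ J.minimalPrimes, ∃ b : R, residue R b = c ∧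
        Polynomial.X - Polynomial.C (C b) ∈ Q}.Finite := by
      have : {c : ResidueField R | ∃ Q ∈ J.minimalPrimes, ∃ b : R, residue R b = c ∧
        Polynomial.X - Polynomial.C (C b) ∈ Q} = ⋃ Q ∈ J.minimalPrimes, {c | ∃ b : R,
          residue R b = c ∧ Polynomial.X - Polynomial.C (C b) ∈ Q} := by ext; simp
      rw [this]
      refine (Ideal.finite_minimalPrimes_of_isNoetherianRing _ J).biUnion fun Q hQ ↦ ?_
      refine Set.Subsingleton.finite ?_
      rintro _ ⟨b, rfl, hb⟩ _ ⟨b', rfl, hb'⟩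
      by_contra hne
      have hu : IsUnit (b' - b) := by
        by_contra h
        rw [← mem_nonunits_iff, ← mem_maximalIdeal, ← residue_eq_zero_iff, map_sub,
          sub_eq_zero] at h
        exact hne h.symm
      have hm : Polynomial.C (C (b' - b)) ∈ Q := by
        have := Q.sub_mem hb hb'
        simpa using this
      exact hQ.isPrime.ne_top
        (Q.eq_top_of_isUnit_mem hm ((hu.map C).map Polynomial.C))
    obtain ⟨c, hc⟩ := (hfin1.union hfin2).infinite_compl.nonempty
    obtain ⟨a₀, rfl⟩ := residue_surjective c
    simp only [Set.mem_compl_iff, Set.mem_union, Set.mem_ofPred_eq, not_or, not_exists,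
      not_and] at hc
    have h1 := Ideal.le_height_map_evalRingHom hJ (C a₀) fun Q hQ ↦ hc.2 Q hQ a₀ rfl
    obtain ⟨a, ha, ha'⟩ := ih _ h1 (Polynomial.eval (C a₀) (e F)) (by
      have := hc.1
      rw [Polynomial.IsRoot.def, Polynomial.eval_map] at this
      rwa [← Polynomial.eval₂_hom, map_C] )
    have hcomp : ((eval a).comp ((Polynomial.evalRingHom (C a₀)).comp (e : _ →+* _))) =
        eval (Fin.cons a₀ a : Fin (n + 1) → R) := by
      apply ringHom_ext
      · intro r; simp [e, finSuccEquiv_apply]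
      · intro i
        refine Fin.cases ?_ (fun j ↦ ?_) i <;> simp [e, finSuccEquiv_apply]
    refine ⟨Fin.cons a₀ a, ?_, ?_⟩
    · rw [← hcomp]; exact ha
    · rw [← hcomp, ← Ideal.map_map, ← Ideal.map_map]; exact ha'

/-! ### Primes containing independent linear forms -/

theorem SymmetricAlgebra.ι_injective_of_field (K V : Type*) [Field K] [AddCommGroup V]
    [Module K V] : Function.Injective (SymmetricAlgebra.ι K V) := by
  refine (injective_iff_map_eq_zero _).2 fun v hv ↦ ?_
  rw [← Module.forall_dual_apply_eq_zero_iff K]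
  intro φ
  rw [← SymmetricAlgebra.lift_ι_apply φ v, hv, map_zero]

namespace MvPolynomial

variable {R : Type*} [CommRing R] (P : Ideal R) [P.IsPrime] {n : ℕ}

/-- The polynomial ring modulo the ideal cut out by the linear forms in `W` over `κ(P)`. -/
noncomputable def toLinearFiber (W : Submodule P.ResidueField (Fin n → P.ResidueField)) :
    MvPolynomial (Fin n) R →+* SymmetricAlgebra P.ResidueField ((Fin n → P.ResidueField) ⧸ W) :=
  eval₂Hom ((algebraMap P.ResidueField _).comp (algebraMap R P.ResidueField))
    fun i ↦ SymmetricAlgebra.ι _ _ (W.mkQ (Pi.single i 1))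

theorem toLinearFiber_linearForm (W : Submodule P.ResidueField (Fin n → P.ResidueField))
    (c : Fin n → R) :
    toLinearFiber P W (∑ i, C (c i) * X i) =
      SymmetricAlgebra.ι _ _ (W.mkQ fun i ↦ algebraMap R P.ResidueField (c i)) := by
  have h : (fun i ↦ algebraMap R P.ResidueField (c i)) =
      ∑ i, algebraMap R P.ResidueField (c i) • Pi.single i (1 : P.ResidueField) := by
    ext j; simp [Finset.sum_apply, Pi.single_apply, Algebra.smul_def]
  rw [h, map_sum, map_sum, map_sum]
  refine Finset.sum_congr rfl fun i _ ↦ ?_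
  rw [map_smul, map_smul, Algebra.smul_def]
  simp [toLinearFiber]

/-- The map to `κ(Q)` factors through the symmetric algebra, because the given forms vanish in
`κ(Q)`. -/
theorem ker_toLinearFiber_le {Q : Ideal (MvPolynomial (Fin n) R)} [Q.IsPrime]
    (hQ : P = Q.comap C) {k : ℕ} (c : Fin k → Fin n → R)
    (hc : ∀ j, ∑ i, C (c j i) * X i ∈ Q) :
    RingHom.ker (toLinearFiber P (Submodule.span P.ResidueField
      (Set.range fun j i ↦ algebraMap R P.ResidueField (c j i)))) ≤ Q := by
  let φ : P.ResidueField →+* Q.ResidueField := Ideal.ResidueField.map P Q C hQ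
  let _ := φ.toAlgebra
  let l : (Fin n → P.ResidueField) →ₗ[P.ResidueField] Q.ResidueField :=
    Fintype.linearCombination P.ResidueField
      fun i ↦ algebraMap (MvPolynomial (Fin n) R) Q.ResidueField (X i)
  have hl : Submodule.span P.ResidueField
      (Set.range fun j i ↦ algebraMap R P.ResidueField (c j i)) ≤ LinearMap.ker l := by
    rw [Submodule.span_le]
    rintro _ ⟨j, rfl⟩
    have := (Ideal.algebraMap_residueField_eq_zero (I := Q)).2 (hc j)
    simp only [map_sum, map_mul] at this
    simp only [SetLike.mem_coe, LinearMap.mem_ker, l, Fintype.linearCombination_apply,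
      Algebra.smul_def]
    rw [← this]
    refine Finset.sum_congr rfl fun i _ ↦ ?_
    congr 1
    exact Ideal.ResidueField.map_algebraMap ..
  let ψ := SymmetricAlgebra.lift (Submodule.liftQ _ l hl)
  have hψ : ψ.toRingHom.comp (toLinearFiber P _) =
      algebraMap (MvPolynomial (Fin n) R) Q.ResidueField := by
    apply ringHom_ext
    · intro r
      simp only [toLinearFiber, RingHom.comp_apply, coe_eval₂Hom, eval₂_C]
      rw [AlgHom.toRingHom_eq_coe, RingHom.coe_coe, AlgHom.commutes]
      exact Ideal.ResidueField.map_algebraMap ..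
    · intro i
      simp [toLinearFiber, ψ, l, Fintype.linearCombination_apply, Pi.single_apply]
  intro f hf
  rw [← Ideal.algebraMap_residueField_eq_zero (I := Q), ← hψ, RingHom.comp_apply,
    (RingHom.mem_ker).1 hf, map_zero]

/-- Induction on the number of forms. With none, going down gives at least `ht P`. Each further form
enlarges the prime strictly: a linear form lies in the kernel only if its coefficient vector lies in
the span. -/
theorem height_add_le_height_ker_toLinearFiber [IsNoetherianRing R] {k : ℕ} (c : Fin k → Fin n → R)
    (hc : LinearIndependent P.ResidueField fun j i ↦ algebraMap R P.ResidueField (c j i)) :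
    P.height + k ≤ (RingHom.ker (toLinearFiber P (Submodule.span P.ResidueField
      (Set.range fun j i ↦ algebraMap R P.ResidueField (c j i))))).height := by
  induction k with
  | zero =>
    set q := RingHom.ker (toLinearFiber P (Submodule.span P.ResidueField
      (Set.range fun j i ↦ algebraMap R P.ResidueField (c j i))))
    have : q.LiesOver P := by
      refine ⟨?_⟩
      ext r
      rw [Ideal.under_def, Ideal.mem_comap, RingHom.mem_ker, algebraMap_eq]
      simp [toLinearFiber]
    have hq : q.IsPrime := RingHom.ker_isPrime _
    rw [Ideal.height_eq_height_add_of_liesOver_of_hasGoingDown P q]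
    simp
  | succ k ih =>
    rw [linearIndependent_finSucc'] at hc
    have h1 := ih (fun j ↦ c j.castSucc) hc.1
    have : (RingHom.ker (toLinearFiber P (Submodule.span P.ResidueField
      (Set.range fun (j : Fin k) i ↦ algebraMap R P.ResidueField (c j.castSucc i))))).IsPrime :=
      RingHom.ker_isPrime _
    have h2 : (RingHom.ker (toLinearFiber P (Submodule.span P.ResidueField
      (Set.range fun j i ↦ algebraMap R P.ResidueField (c j i))))).IsPrime :=
      RingHom.ker_isPrime _
    have hP : P = (RingHom.ker (toLinearFiber P (Submodule.span P.ResidueField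
      (Set.range fun j i ↦ algebraMap R P.ResidueField (c j i))))).comap C := by
      ext r
      rw [Ideal.mem_comap, RingHom.mem_ker]
      simp [toLinearFiber]
    have hmem (j) : ∑ i, C (c j i) * X i ∈ RingHom.ker (toLinearFiber P
        (Submodule.span P.ResidueField
          (Set.range fun j i ↦ algebraMap R P.ResidueField (c j i)))) := by
      have h0 := (Submodule.Quotient.mk_eq_zero _).2 (Submodule.subset_span (R := P.ResidueField)
        (Set.mem_range_self (f := fun j i ↦ algebraMap R P.ResidueField (c j i)) j))
      rw [RingHom.mem_ker, toLinearFiber_linearForm, Submodule.mkQ_apply, h0, map_zero]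
    refine le_trans ?_ (Ideal.height_add_one_le_of_lt_of_isPrime (lt_of_le_of_ne
      (ker_toLinearFiber_le P hP (fun j : Fin k ↦ c j.castSucc) fun j ↦ hmem _) fun h ↦ ?_))
    · push_cast
      rw [← add_assoc]
      gcongr
    · have := hmem (Fin.last k)
      rw [← h, RingHom.mem_ker, toLinearFiber_linearForm] at this
      have h0 := (map_eq_zero_iff _ (SymmetricAlgebra.ι_injective_of_field _ _)).1 this
      rw [Submodule.mkQ_apply, Submodule.Quotient.mk_eq_zero] at h0
      exact hc.2 h0

/-- A prime over `P` containing `k` linear forms that are independent over `κ(P)` has height at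
least `ht P + k`. -/
theorem height_add_le_height [IsNoetherianRing R] {Q : Ideal (MvPolynomial (Fin n) R)} [Q.IsPrime]
    (hQ : P = Q.comap C) {k : ℕ} (c : Fin k → Fin n → R)
    (hcQ : ∀ j, ∑ i, C (c j i) * X i ∈ Q)
    (hc : LinearIndependent P.ResidueField fun j i ↦ algebraMap R P.ResidueField (c j i)) :
    P.height + k ≤ Q.height :=
  (height_add_le_height_ker_toLinearFiber P c hc).trans
    (Ideal.height_mono (ker_toLinearFiber_le P hQ c hcQ))

end MvPolynomial

/-! ### Free summands and functionals independent over the residue field -/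

namespace OrderIdeals

section Localization

variable {R : Type u} {N : Type v} [CommRing R] [AddCommGroup N] [Module R N]
  (P : Ideal R) [P.IsPrime] {n : ℕ} {x : Fin n → N}

theorem span_range_mkLinearMap_eq_top (hx : Submodule.span R (Set.range x) = ⊤) :
    Submodule.span (Localization.AtPrime P)
      (Set.range fun i ↦ LocalizedModule.mkLinearMap P.primeCompl N (x i)) = ⊤ := by
  have := span_eq_top_of_isLocalizedModule (Localization.AtPrime P) P.primeCompl
    (LocalizedModule.mkLinearMap P.primeCompl N) hx
  rwa [← Set.range_comp] at this

/-- A functional on `N_P` is, up to a unit, the localization of a functional on `N`. -/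
theorem exists_dual_localization [Module.FinitePresentation R N]
    (g : LocalizedModule P.primeCompl N →ₗ[Localization.AtPrime P] Localization.AtPrime P) :
    ∃ (f : Module.Dual R N) (s : P.primeCompl), ∀ y, algebraMap R (Localization.AtPrime P) (f y) =
      algebraMap R (Localization.AtPrime P) s *
        g (LocalizedModule.mkLinearMap P.primeCompl N y) := by
  obtain ⟨f, s, h⟩ := Module.FinitePresentation.exists_lift_of_isLocalizedModule P.primeCompl
    (Algebra.linearMap R (Localization.AtPrime P))
    (g.restrictScalars R ∘ₗ LocalizedModule.mkLinearMap P.primeCompl N)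
  refine ⟨f, s, fun y ↦ ?_⟩
  have := congr($h y)
  rw [← Algebra.smul_def]
  exact this

theorem algebraMap_primeCompl_ne_zero (s : P.primeCompl) :
    algebraMap R P.ResidueField s ≠ 0 :=
  fun h ↦ s.2 (Ideal.algebraMap_residueField_eq_zero.1 h)

/-- A free direct summand of rank `k` of `N_P` yields `k` functionals on `N` that are independent
over the residue field at `P`. -/
theorem exists_dual_linearIndependent [Module.FinitePresentation R N]
    (hx : Submodule.span R (Set.range x) = ⊤) {k : ℕ}
    (i : (Fin k → Localization.AtPrime P) →ₗ[Localization.AtPrime P]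
      LocalizedModule P.primeCompl N)
    (p : LocalizedModule P.primeCompl N →ₗ[Localization.AtPrime P]
      (Fin k → Localization.AtPrime P)) (h : p ∘ₗ i = LinearMap.id) :
    ∃ f : Fin k → Module.Dual R N, LinearIndependent P.ResidueField
      fun j i ↦ algebraMap R P.ResidueField (f j (x i)) := by
  choose f s hf using fun j ↦ exists_dual_localization P (LinearMap.proj j ∘ₗ p)
  refine ⟨f, Fintype.linearIndependent_iff.2 fun t ht l ↦ ?_⟩
  -- The factors `s j` account for the cleared denominators, so a relation `t` makes `θ` vanish on
  -- generators. Its value on the `l`-th vector of the summand isolates `t l * s l`.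
  let θ : LocalizedModule P.primeCompl N →ₗ[Localization.AtPrime P] P.ResidueField :=
    ∑ j, (t j * algebraMap R P.ResidueField (s j)) •
      (Algebra.linearMap (Localization.AtPrime P) P.ResidueField ∘ₗ LinearMap.proj j ∘ₗ p)
  have hθ : θ = 0 := by
    refine LinearMap.ext_on_range (span_range_mkLinearMap_eq_top P hx) fun i ↦ ?_
    have hi := congr($ht i)
    simp only [Finset.sum_apply, Pi.smul_apply, smul_eq_mul, Pi.zero_apply] at hi
    rw [LinearMap.zero_apply, ← hi]
    simp only [θ, LinearMap.sum_apply, LinearMap.smul_apply, smul_eq_mul]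
    refine Finset.sum_congr rfl fun j _ ↦ ?_
    rw [mul_assoc]
    congr 1
    rw [IsScalarTower.algebraMap_apply R (Localization.AtPrime P) P.ResidueField (f j (x i)), hf,
      map_mul, ← IsScalarTower.algebraMap_apply]
    rfl
  have hl : θ (i (Pi.single l 1)) = 0 := by rw [hθ]; rfl
  have hp : p (i (Pi.single l 1)) = Pi.single l 1 := congr($h (Pi.single l 1))
  simp only [θ, LinearMap.sum_apply, LinearMap.smul_apply, smul_eq_mul, LinearMap.comp_apply,
    hp, LinearMap.proj_apply, Algebra.linearMap_apply] at hl
  rw [Finset.sum_eq_single l (by intro j _ hj; simp [hj]) (by simp)] at hl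
  simp only [Pi.single_eq_same, map_one, mul_one] at hl
  exact (mul_eq_zero.1 hl).resolve_right (algebraMap_primeCompl_ne_zero P (s l))

/-- Functionals on `N` that are independent over the residue field at `P` split off a free
direct summand of `N_P`. -/
theorem exists_split_of_linearIndependent {k : ℕ} (f : Fin k → Module.Dual R N)
    (hf : LinearIndependent P.ResidueField fun j i ↦ algebraMap R P.ResidueField (f j (x i))) :
    ∃ (i : (Fin k → Localization.AtPrime P) →ₗ[Localization.AtPrime P]
        LocalizedModule P.primeCompl N)
      (p : LocalizedModule P.primeCompl N →ₗ[Localization.AtPrime P]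
        (Fin k → Localization.AtPrime P)), p ∘ₗ i = LinearMap.id := by
  let v : Fin k → Fin n → P.ResidueField := fun j i ↦ algebraMap R P.ResidueField (f j (x i))
  obtain ⟨g, hg⟩ := LinearMap.exists_leftInverse_of_injective
    (Fintype.linearCombination P.ResidueField v)
    (LinearMap.ker_eq_bot.2 hf.fintypeLinearCombination_injective)
  have hgv (j) : g (v j) = Pi.single j 1 := by
    have := congr($hg (Pi.single j 1))
    simpa [Fintype.linearCombination_apply, Pi.single_apply] using this
  choose c hc using fun l i ↦ IsLocalRing.residue_surjective (R := Localization.AtPrime P)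
    (g (Pi.single i 1) l)
  let ι : (Fin k → Localization.AtPrime P) →ₗ[Localization.AtPrime P]
      LocalizedModule P.primeCompl N := Fintype.linearCombination _
    fun l ↦ ∑ i, c l i • LocalizedModule.mkLinearMap P.primeCompl N (x i)
  let p : LocalizedModule P.primeCompl N →ₗ[Localization.AtPrime P]
      (Fin k → Localization.AtPrime P) := LinearMap.pi fun j ↦
    IsLocalizedModule.mapExtendScalars P.primeCompl (LocalizedModule.mkLinearMap P.primeCompl N)
      (Algebra.linearMap R (Localization.AtPrime P)) (Localization.AtPrime P) (f j)
  have hp (j) (y : N) : p (LocalizedModule.mkLinearMap P.primeCompl N y) j =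
      algebraMap R (Localization.AtPrime P) (f j y) := by
    simp only [p, LinearMap.pi_apply]
    exact IsLocalizedModule.map_apply P.primeCompl _ (Algebra.linearMap R _) (f j) y
  -- The coefficients `c` lift a dual family to the value vectors, so `p ∘ ι` is the identity modulo
  -- the maximal ideal; inverting it corrects `p` to a splitting.
  have hdet : IsUnit (LinearMap.det (p ∘ₗ ι)) := by
    rw [← LinearMap.det_toMatrix', ← isUnit_map_iff (IsLocalRing.residue (Localization.AtPrime P)),
      RingHom.map_det]
    have : (IsLocalRing.residue (Localization.AtPrime P)).mapMatrix
        (LinearMap.toMatrix' (p ∘ₗ ι)) = 1 := by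
      ext j l
      have h1 : ι (Pi.single l 1) =
          ∑ i, c l i • LocalizedModule.mkLinearMap P.primeCompl N (x i) := by
        simp [ι, Fintype.linearCombination_apply, Pi.single_apply]
      have h2 : v j = ∑ i, v j i • Pi.single i (1 : P.ResidueField) := by
        ext a; simp [Finset.sum_apply, Pi.single_apply]
      have h3 := congr($(hgv j) l)
      rw [h2, map_sum] at h3
      simp only [map_smul, Finset.sum_apply, Pi.smul_apply, smul_eq_mul] at h3
      rw [RingHom.mapMatrix_apply, Matrix.map_apply, LinearMap.toMatrix'_apply,
        LinearMap.comp_apply]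
      simp only [h1, map_sum, map_smul, Finset.sum_apply, Pi.smul_apply, hp, smul_eq_mul, map_mul,
        hc]
      rw [Matrix.one_apply]
      rw [Pi.single_apply] at h3
      simp only [@eq_comm _ j l]
      rw [← h3]
      refine Finset.sum_congr rfl fun i _ ↦ ?_
      rw [mul_comm]
      rfl
    rw [this]
    simp
  rw [← LinearMap.isUnit_iff_isUnit_det] at hdet
  obtain ⟨E, hE⟩ := hdet
  refine ⟨ι, (E⁻¹ : (Module.End _ _)ˣ).1 ∘ₗ p, ?_⟩
  rw [LinearMap.comp_assoc, ← hE]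
  exact E.inv_mul

end Localization

section

variable {R : Type u} {N : Type v} [CommRing R] [AddCommGroup N] [Module R N]
  (P : PrimeSpectrum R) {n : ℕ} {x : Fin n → N}

/-- A summand of rank `k` gives `k` independent vectors in `κ(P)^n`. Boundedness is essential
because `sSup` of an unbounded set of naturals is `0`. -/
theorem bddAbove_setOf_split [Module.FinitePresentation R N]
    (hx : Submodule.span R (Set.range x) = ⊤) :
    BddAbove {k : ℕ | ∃ (i : (Fin k → Localization.AtPrime P.asIdeal)
        →ₗ[Localization.AtPrime P.asIdeal] LocalizedModule P.asIdeal.primeCompl N)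
      (p : LocalizedModule P.asIdeal.primeCompl N →ₗ[Localization.AtPrime P.asIdeal]
        (Fin k → Localization.AtPrime P.asIdeal)), p ∘ₗ i = LinearMap.id} := by
  refine ⟨n, ?_⟩
  rintro k ⟨i, p, h⟩
  obtain ⟨f, hf⟩ := exists_dual_linearIndependent P.asIdeal hx i p h
  simpa using hf.fintype_card_le_finrank

theorem exists_dual_linearIndependent_rf [Module.FinitePresentation R N]
    (hx : Submodule.span R (Set.range x) = ⊤) :
    ∃ f : Fin (rf R N P) → Module.Dual R N, LinearIndependent P.asIdeal.ResidueField
      fun j i ↦ algebraMap R P.asIdeal.ResidueField (f j (x i)) := by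
  have h0 : rf R N P ∈ _ := Nat.sSup_mem (by exact ⟨0, 0, 0, Subsingleton.elim _ _⟩)
    (bddAbove_setOf_split P hx)
  obtain ⟨i, p, h⟩ := h0
  exact exists_dual_linearIndependent P.asIdeal hx i p h

theorem le_rf_of_linearIndependent [Module.FinitePresentation R N]
    (hx : Submodule.span R (Set.range x) = ⊤) {k : ℕ} (f : Fin k → Module.Dual R N)
    (hf : LinearIndependent P.asIdeal.ResidueField
      fun j i ↦ algebraMap R P.asIdeal.ResidueField (f j (x i))) : k ≤ rf R N P :=
  le_csSup (bddAbove_setOf_split P hx) (exists_split_of_linearIndependent P.asIdeal f hf)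

theorem finrank_le_rf [Module.FinitePresentation R N]
    (hx : Submodule.span R (Set.range x) = ⊤)
    [Module.Free (Localization.AtPrime P.asIdeal) (LocalizedModule P.asIdeal.primeCompl N)] :
    Module.finrank (Localization.AtPrime P.asIdeal) (LocalizedModule P.asIdeal.primeCompl N) ≤
      rf R N P := by
  let e := (Module.finBasis (Localization.AtPrime P.asIdeal)
    (LocalizedModule P.asIdeal.primeCompl N)).equivFun
  exact le_csSup (bddAbove_setOf_split P hx) ⟨e.symm.toLinearMap, e.toLinearMap, by ext; simp⟩

end

end OrderIdeals

/-! ### The perpendicular module and its local ranks -/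

namespace OrderIdeals

section Perp

variable {R : Type u} {N : Type v} [CommRing R] [AddCommGroup N] [Module R N] {n : ℕ}
  (x : Fin n → N)

/-- The generators of `N^⊥` given by the coordinate functions. -/
def perpGen (i : Fin n) : Perp R x :=
  Submodule.Quotient.mk (LinearMap.proj i)

theorem dual_eq_sum_proj (φ : Module.Dual R (Fin n → R)) :
    φ = ∑ i, φ (Pi.single i 1) • (LinearMap.proj i : (Fin n → R) →ₗ[R] R) := by
  ext i
  simp [Pi.single_apply]

theorem span_range_perpGen : Submodule.span R (Set.range (perpGen (R := R) x)) = ⊤ := by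
  refine top_unique fun y _ ↦ ?_
  obtain ⟨φ, rfl⟩ := Submodule.Quotient.mk_surjective _ y
  rw [dual_eq_sum_proj φ, ← Submodule.mkQ_apply, map_sum]
  refine Submodule.sum_mem _ fun i _ ↦ ?_
  rw [map_smul]
  exact Submodule.smul_mem _ _ (Submodule.subset_span ⟨i, rfl⟩)

theorem sum_smul_perpGen (f : Module.Dual R N) : ∑ i, f (x i) • perpGen (R := R) x i = 0 := by
  have : ∑ i, f (x i) • perpGen (R := R) x i = Submodule.Quotient.mk
      (∑ i, f (x i) • (LinearMap.proj i : (Fin n → R) →ₗ[R] R)) := by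
    rw [← Submodule.mkQ_apply, map_sum]
    simp only [map_smul]
    rfl
  rw [this, Submodule.Quotient.mk_eq_zero]
  refine ⟨f, ?_⟩
  rw [dual_eq_sum_proj ((Fintype.linearCombination R x).dualMap f)]
  simp [Fintype.linearCombination_apply, Pi.single_apply]

/-- The map out of `N^⊥` sending its generators to vectors `w i` that satisfy the relations given by
the functionals on `N`. -/
def perpLift {V : Type*} [AddCommGroup V] [Module R V] (w : Fin n → V)
    (hw : ∀ f : Module.Dual R N, ∑ i, f (x i) • w i = 0) : Perp R x →ₗ[R] V :=
  Submodule.liftQ _ (∑ i, (LinearMap.toSpanSingleton R V (w i)) ∘ₗ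
    Module.Dual.eval R (Fin n → R) (Pi.single i 1)) <| by
    rintro _ ⟨f, rfl⟩
    simpa [LinearMap.sum_apply, Fintype.linearCombination_apply, Pi.single_apply] using hw f

theorem perpLift_perpGen {V : Type*} [AddCommGroup V] [Module R V] (w : Fin n → V)
    (hw : ∀ f : Module.Dual R N, ∑ i, f (x i) • w i = 0) (i : Fin n) :
    perpLift x w hw (perpGen x i) = w i := by
  rw [perpLift, perpGen, ← Submodule.mkQ_apply, ← LinearMap.comp_apply, Submodule.liftQ_mkQ]
  simp [LinearMap.sum_apply, Pi.single_apply]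

variable (P : PrimeSpectrum R)

/-- `n - dim W ≤ μ_P(N^⊥)`, where `W` is the span over `κ(P)` of the value vectors of
functionals on `N`. -/
theorem finrank_quotient_le_minGensAt_perp :
    Module.finrank P.asIdeal.ResidueField ((Fin n → P.asIdeal.ResidueField) ⧸
      Submodule.span P.asIdeal.ResidueField (Set.range fun (f : Module.Dual R N) i ↦
        algebraMap R P.asIdeal.ResidueField (f (x i)))) ≤ minGensAt R (Perp R x) P := by
  set κ := P.asIdeal.ResidueField
  set A := Localization.AtPrime P.asIdeal
  set W := Submodule.span κ (Set.range fun (f : Module.Dual R N) i ↦ algebraMap R κ (f (x i)))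
  let w : Fin n → (Fin n → κ) ⧸ W := fun i ↦ W.mkQ (Pi.single i 1)
  let g : Perp R x →ₗ[R] (Fin n → κ) ⧸ W := perpLift x w fun f ↦ by
    have : ∑ i, f (x i) • w i = W.mkQ fun i ↦ algebraMap R κ (f (x i)) := by
      have h2 : (fun i ↦ algebraMap R κ (f (x i))) =
          ∑ i, algebraMap R κ (f (x i)) • Pi.single i (1 : κ) := by
        ext a; simp [Finset.sum_apply, Pi.single_apply, Algebra.smul_def]
      rw [h2, map_sum]
      refine Finset.sum_congr rfl fun i _ ↦ ?_
      rw [map_smul, algebraMap_smul]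
    rw [this, Submodule.mkQ_apply, Submodule.Quotient.mk_eq_zero]
    exact Submodule.subset_span ⟨f, rfl⟩
  -- Elements outside `P` act invertibly on the target, so `g` extends to the localization; minimal
  -- generators there then span `κ(P)^n / W`.
  have hunit (s : P.asIdeal.primeCompl) :
      IsUnit (algebraMap R (Module.End R ((Fin n → κ) ⧸ W)) s) := by
    have h0 := (isUnit_iff_ne_zero.2 (algebraMap_primeCompl_ne_zero P.asIdeal s))
    rw [Module.End.isUnit_iff]
    have : ⇑(algebraMap R (Module.End R ((Fin n → κ) ⧸ W)) s) =
        fun y ↦ algebraMap R κ s • y := by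
      ext y
      rw [algebraMap_smul]; rfl
    rw [this]
    exact h0.smul_bijective
  let g' := (LocalizedModule.lift P.asIdeal.primeCompl g hunit).extendScalarsOfIsLocalization
    P.asIdeal.primeCompl A
  have hg' (y) : g' (LocalizedModule.mkLinearMap P.asIdeal.primeCompl (Perp R x) y) = g y :=
    congr($(LocalizedModule.lift_comp P.asIdeal.primeCompl g hunit) y)
  obtain ⟨t, ht, hts⟩ := (Module.Finite.fg_top (R := A)
    (M := LocalizedModule P.asIdeal.primeCompl (Perp R x))).exists_span_finset_card_eq_spanFinrank
  have hmem (y) : g' y ∈ Submodule.span κ (g' '' t) := by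
    have hy : y ∈ Submodule.span A (t : Set (LocalizedModule P.asIdeal.primeCompl (Perp R x))) :=
      hts ▸ Submodule.mem_top
    have h1 := Submodule.mem_map_of_mem (f := g') hy
    rw [Submodule.map_span] at h1
    exact Submodule.span_le_restrictScalars A κ _ h1
  have htop : Submodule.span κ (g' '' t) = ⊤ := by
    refine top_unique fun y _ ↦ ?_
    obtain ⟨c, rfl⟩ := W.mkQ_surjective y
    have h2 : c = ∑ i, c i • Pi.single i (1 : κ) := by
      ext a; simp [Finset.sum_apply, Pi.single_apply]
    rw [h2, map_sum]
    refine Submodule.sum_mem _ fun i _ ↦ ?_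
    rw [map_smul]
    refine Submodule.smul_mem _ _ ?_
    have := hmem (LocalizedModule.mkLinearMap P.asIdeal.primeCompl (Perp R x) (perpGen x i))
    rwa [hg', perpLift_perpGen] at this
  classical
  rw [← finrank_top, ← htop, ← Finset.coe_image]
  exact (finrank_span_finset_le_card _).trans (Finset.card_image_le.trans ht.le)

/-- A basis of `W` chosen among the value vectors splits off a free summand of rank `dim W`, while
`n - dim W ≤ μ_P(N^⊥)`. -/
theorem le_minGensAt_perp_add_rf [Module.FinitePresentation R N]
    (hx : Submodule.span R (Set.range x) = ⊤) :
    n ≤ minGensAt R (Perp R x) P + rf R N P := by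
  have h1 := finrank_quotient_le_minGensAt_perp x P
  have h2 := Submodule.finrank_quotient_add_finrank (Submodule.span P.asIdeal.ResidueField
    (Set.range fun (f : Module.Dual R N) i ↦ algebraMap R P.asIdeal.ResidueField (f (x i))))
  obtain ⟨v, hv, -, hli⟩ := Submodule.exists_fun_fin_finrank_span_eq P.asIdeal.ResidueField
    (Set.range fun (f : Module.Dual R N) i ↦ algebraMap R P.asIdeal.ResidueField (f (x i)))
  choose f hf using hv
  obtain rfl : (fun j ↦ _) = v := funext hf
  have h3 := le_rf_of_linearIndependent P hx f hli
  rw [Module.finrank_fin_fun] at h2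
  omega

/-- If `N^⊥` is free at `P`, then the ranks of `N^⊥` and of a free summand of `N` at `P` add up
to at most the number of generators. -/
theorem finrank_perp_add_rf_le [Module.FinitePresentation R N]
    (hx : Submodule.span R (Set.range x) = ⊤)
    [Module.Free (Localization.AtPrime P.asIdeal)
      (LocalizedModule P.asIdeal.primeCompl (Perp R x))] :
    Module.finrank (Localization.AtPrime P.asIdeal)
      (LocalizedModule P.asIdeal.primeCompl (Perp R x)) + rf R N P ≤ n := by
  set κ := P.asIdeal.ResidueField
  set A := Localization.AtPrime P.asIdeal
  obtain ⟨f, hf⟩ := exists_dual_linearIndependent_rf P hx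
  let b := Module.finBasis A (LocalizedModule P.asIdeal.primeCompl (Perp R x))
  let mk := LocalizedModule.mkLinearMap P.asIdeal.primeCompl (Perp R x)
  set e := Module.finrank A (LocalizedModule P.asIdeal.primeCompl (Perp R x))
  let ρ : LocalizedModule P.asIdeal.primeCompl (Perp R x) →ₗ[A] (Fin e → κ) :=
    LinearMap.pi fun j ↦ Algebra.linearMap A κ ∘ₗ b.coord j
  -- This map is onto and kills the `rf_P(N)` independent value vectors; rank-nullity gives the
  -- bound.
  let χ : (Fin n → κ) →ₗ[κ] (Fin e → κ) :=
    Fintype.linearCombination κ fun i ↦ ρ (mk (perpGen x i))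
  have hρ (y) : ρ y ∈ (LinearMap.range χ).restrictScalars A := by
    have hy : y ∈ Submodule.span A (Set.range fun i ↦ mk (perpGen x i)) := by
      rw [span_range_mkLinearMap_eq_top P.asIdeal (span_range_perpGen x)]
      trivial
    refine (Submodule.span_le (p := ((LinearMap.range χ).restrictScalars A).comap ρ)).2 ?_ hy
    rintro _ ⟨i, rfl⟩
    exact ⟨Pi.single i 1, by simp [χ, Fintype.linearCombination_apply, Pi.single_apply]⟩
  have hsurj : LinearMap.range χ = ⊤ := by
    refine top_unique fun c _ ↦ ?_
    have h2 : c = ∑ i, c i • Pi.single i (1 : κ) := by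
      ext a; simp [Finset.sum_apply, Pi.single_apply]
    rw [h2]
    refine Submodule.sum_mem _ fun j _ ↦ Submodule.smul_mem _ _ ?_
    have h3 : ρ (b j) = Pi.single j 1 := by
      ext l
      by_cases h : l = j
      · subst h; simp [ρ]
      · simp [ρ, h]
    rw [← h3]
    exact hρ (b j)
  have hker : Submodule.span κ (Set.range fun j i ↦ algebraMap R κ (f j (x i))) ≤
      LinearMap.ker χ := by
    rw [Submodule.span_le]
    rintro _ ⟨j, rfl⟩
    have := congr(ρ (mk $(sum_smul_perpGen x (f j))))
    rw [map_zero, map_zero, map_sum, map_sum] at this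
    rw [SetLike.mem_coe, LinearMap.mem_ker, ← this]
    simp only [χ, Fintype.linearCombination_apply]
    refine Finset.sum_congr rfl fun i _ ↦ ?_
    rw [map_smul, algebraMap_smul]
    exact (LinearMap.map_smul_of_tower ρ (f j (x i)) _).symm
  have h4 := χ.finrank_range_add_finrank_ker
  have h5 := Submodule.finrank_mono hker
  rw [finrank_span_eq_card hf, Fintype.card_fin] at h5
  rw [hsurj, finrank_top, Module.finrank_fin_fun, Module.finrank_fin_fun] at h4
  omega

end Perp

theorem localDim_eq_height {R : Type u} [CommRing R] (P : PrimeSpectrum R) :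
    localDim R P = P.asIdeal.height :=
  IsLocalization.AtPrime.ringKrullDim_eq_height P.asIdeal _

theorem largeFreeSummands_of_satisfiesGInfty {R : Type u} {N : Type v} [CommRing R]
    [IsNoetherianRing R] [Nontrivial R] [AddCommGroup N] [Module R N] [Module.Finite R N] {n : ℕ}
    {x : Fin n → N} (hx : Submodule.span R (Set.range x) = ⊤) {r : ℕ} (hN : HasGenericRank R N r)
    (hG : SatisfiesGInfty R (Perp R x)) : LargeFreeSummands R N r := by
  have : Module.FinitePresentation R N := Module.finitePresentation_of_finite R N
  intro P hP
  obtain ⟨h, hh⟩ := ENat.ne_top_iff_exists.1 (P.asIdeal.height_ne_top P.isPrime.ne_top)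
  rw [localDim_eq_height, ← hh]
  have h0 : h ≠ 0 := by
    rintro rfl
    refine hP (hN P ?_).1
    rw [← Ideal.height_eq_zero_iff]
    exact hh.symm
  -- The least index whose condition reaches primes of height `h`.
  obtain ⟨e, he, hμ⟩ := hG (h + 1) (by omega)
  have hμP := hμ P (by rw [localDim_eq_height, ← hh]; exact_mod_cast Nat.one_le_iff_ne_zero.2 h0)
    (by rw [localDim_eq_height, ← hh]; exact_mod_cast le_rfl)
  rw [localDim_eq_height, ← hh] at hμP
  -- Any minimal prime serves to obtain `e + r ≤ n`.
  obtain ⟨Q, hQ⟩ := Ideal.nonempty_minimalPrimes (bot_ne_top (α := Ideal R))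
  let Q' : PrimeSpectrum R := ⟨Q, hQ.isPrime⟩
  have := (he Q' hQ).1
  have h1 := finrank_perp_add_rf_le x Q' hx
  have := (hN Q' hQ).1
  have h2 := finrank_le_rf Q' hx
  rw [(hN Q' hQ).2] at h2
  rw [(he Q' hQ).2] at h1
  have h3 := le_minGensAt_perp_add_rf x P hx
  have h4 : minGensAt R (Perp R x) P + 1 ≤ h + e := by exact_mod_cast hμP
  have : r + 1 ≤ rf R N P + h := by omega
  exact_mod_cast this

end OrderIdeals

/-! ### Equations of the Rees algebra and analytic spread -/

namespace OrderIdeals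

section Rees

variable {R : Type u} {N : Type v} [CommRing R] [AddCommGroup N] [Module R N] {n : ℕ}
  (x : Fin n → N)

/-- The presentation of `Sym(N^⊥)` by a polynomial ring. -/
noncomputable def perpPresentation :
    MvPolynomial (Fin n) R →ₐ[R] SymmetricAlgebra R (Perp R x) :=
  MvPolynomial.aeval fun i ↦ SymmetricAlgebra.ι R _ (perpGen x i)

theorem perpPresentation_surjective : Function.Surjective (perpPresentation (R := R) x) := by
  rw [← AlgHom.range_eq_top]
  refine top_unique fun y _ ↦ ?_
  induction y using SymmetricAlgebra.induction with
  | algebraMap r => exact Subalgebra.algebraMap_mem _ r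
  | ι y =>
    have hy : y ∈ Submodule.span R (Set.range (perpGen (R := R) x)) :=
      span_range_perpGen (R := R) x ▸ Submodule.mem_top
    refine (Submodule.span_le (p := (Subalgebra.toSubmodule (perpPresentation x).range).comap
      (SymmetricAlgebra.ι R _))).2 ?_ hy
    rintro _ ⟨i, rfl⟩
    exact ⟨MvPolynomial.X i, by simp [perpPresentation]⟩
  | mul a b ha hb => exact Subalgebra.mul_mem _ (ha trivial) (hb trivial)
  | add a b ha hb => exact Subalgebra.add_mem _ (ha trivial) (hb trivial)

theorem symMap_eq_zero_of_mem_reesIdeal {M : Type v} [AddCommGroup M] [Module R M]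
    {y : SymmetricAlgebra R M} (hy : y ∈ reesIdeal R M) {G : Type u} [AddCommGroup G] [Module R G]
    [Module.Free R G] (g : M →ₗ[R] G) : symMap g y = 0 := by
  simp only [reesIdeal, Ideal.mem_iInf] at hy
  exact hy G _ _ inferInstance g

variable {x}

/-- If `N_P` is free and `N^*(y) ⊆ P`, then `y ∈ P N_P`: clearing denominators, some multiple of
the coefficient vector of `y` is congruent modulo `P` to a relation on the generators. -/
theorem exists_relation_of_orderIdeal_le [Module.Finite R N] [Module.FinitePresentation R N]
    (hx : Submodule.span R (Set.range x) = ⊤)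
    {P : PrimeSpectrum R} (hP : P ∈ Module.freeLocus R N) {a : Fin n → R}
    (ha : orderIdeal R (∑ i, a i • x i) ≤ P.asIdeal) :
    ∃ s ∉ P.asIdeal, ∃ b : Fin n → R, ∑ i, b i • x i = 0 ∧ ∀ i, s * a i - b i ∈ P.asIdeal := by
  set A := Localization.AtPrime P.asIdeal
  set y := ∑ i, a i • x i with hy
  let mk := LocalizedModule.mkLinearMap P.asIdeal.primeCompl N
  have : Module.Free A (LocalizedModule P.asIdeal.primeCompl N) := hP
  let b := Module.finBasis A (LocalizedModule P.asIdeal.primeCompl N)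
  have hcoord (j) : b.coord j (mk y) ∈ IsLocalRing.maximalIdeal A := by
    obtain ⟨f, s, hf⟩ := exists_dual_localization P.asIdeal (b.coord j)
    have h1 : algebraMap R A (f y) ∈ IsLocalRing.maximalIdeal A :=
      (IsLocalization.AtPrime.to_map_mem_maximal_iff A P.asIdeal (f y)).2 (ha ⟨f, rfl⟩)
    rw [hf] at h1
    refine ((IsLocalRing.maximalIdeal.isMaximal A).isPrime.mem_or_mem h1).resolve_left fun h ↦ s.2 ?_
    exact (IsLocalization.AtPrime.to_map_mem_maximal_iff A P.asIdeal _).1 h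
  have hmem : mk y ∈ IsLocalRing.maximalIdeal A •
      Submodule.span A (Set.range fun i ↦ mk (x i)) := by
    rw [span_range_mkLinearMap_eq_top P.asIdeal hx, ← b.sum_repr (mk y)]
    exact Submodule.sum_mem _ fun j _ ↦ Submodule.smul_mem_smul (hcoord j) trivial
  rw [Submodule.mem_ideal_smul_span_iff_exists_sum] at hmem
  obtain ⟨c, hc, hcy⟩ := hmem
  rw [Finsupp.sum_fintype _ _ (by simp)] at hcy
  -- Here `s` clears the denominators of `c`; below, `t` turns the equality in the localization into
  -- one in `N`.
  obtain ⟨s, hs⟩ := IsLocalization.exist_integer_multiples_of_finite P.asIdeal.primeCompl c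
  choose p hp using hs
  have hpP (i) : p i ∈ P.asIdeal := by
    rw [← IsLocalization.AtPrime.to_map_mem_maximal_iff A P.asIdeal, hp, Algebra.smul_def]
    exact Ideal.mul_mem_left _ _ (hc i)
  have hzero : mk ((s : R) • y) = mk (∑ i, p i • x i) := by
    rw [map_smul, ← hcy, map_sum, Finset.smul_sum]
    refine Finset.sum_congr rfl fun i _ ↦ ?_
    rw [map_smul, ← algebraMap_smul A (p i), hp, smul_assoc]
  obtain ⟨t, ht⟩ := (IsLocalizedModule.eq_iff_exists P.asIdeal.primeCompl mk).1 hzero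
  refine ⟨t * s, fun h ↦ (P.isPrime.mem_or_mem h).elim t.2 s.2, fun i ↦ t * (s * a i - p i), ?_, ?_⟩
  · have : (t : R) • (s : R) • y = (t : R) • ∑ i, p i • x i := ht
    rw [← sub_eq_zero, hy, Finset.smul_sum, Finset.smul_sum, Finset.smul_sum,
      ← Finset.sum_sub_distrib] at this
    rw [← this]
    refine Finset.sum_congr rfl fun i _ ↦ ?_
    simp only [mul_sub, sub_smul, mul_smul]
  · intro i
    have : (t : R) * s * a i - t * (s * a i - p i) = t * p i := by ring
    rw [this]
    exact Ideal.mul_mem_left _ _ (hpP i)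

/-- A relation `b` defines a functional on `N^⊥`, so `F(b_1 t, …, b_n t) = 0` in `Sym(R) = R[t]`,
even for inhomogeneous `F`. Setting `t = s⁻¹` in `κ(P)` gives `F(a) = 0` there, because `b ≡ s a`
modulo `P`. -/
theorem eval_mem_of_mem_reesIdeal [Module.Finite R N] [Module.FinitePresentation R N]
    (hx : Submodule.span R (Set.range x) = ⊤)
    {F : MvPolynomial (Fin n) R} (hF : perpPresentation x F ∈ reesIdeal R (Perp R x))
    {P : PrimeSpectrum R} (hP : P ∈ Module.freeLocus R N) {a : Fin n → R}
    (ha : orderIdeal R (∑ i, a i • x i) ≤ P.asIdeal) :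
    MvPolynomial.eval a F ∈ P.asIdeal := by
  obtain ⟨s, hs, b, hb, hab⟩ := exists_relation_of_orderIdeal_le hx hP ha
  set κ := P.asIdeal.ResidueField
  let g : Perp R x →ₗ[R] R := perpLift x b fun f ↦ by
    have := congr(f $hb)
    simp only [map_sum, map_smul, map_zero, smul_eq_mul] at this
    rw [← this]
    exact Finset.sum_congr rfl fun i _ ↦ mul_comm _ _
  have hg := symMap_eq_zero_of_mem_reesIdeal hF g
  have hs' : algebraMap R κ s ≠ 0 := fun h ↦ hs (Ideal.algebraMap_residueField_eq_zero.1 h)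
  let ψ : SymmetricAlgebra R R →ₐ[R] κ :=
    SymmetricAlgebra.lift (LinearMap.toSpanSingleton R κ (algebraMap R κ s)⁻¹)
  have hcomp : (ψ.comp (symMap g)).comp (perpPresentation x) =
      MvPolynomial.aeval fun i ↦ algebraMap R κ (a i) := by
    apply MvPolynomial.algHom_ext
    intro i
    have h1 : algebraMap R κ s * algebraMap R κ (a i) = algebraMap R κ (b i) := by
      rw [← map_mul, ← sub_eq_zero, ← map_sub]
      exact Ideal.algebraMap_residueField_eq_zero.2 (hab i)
    simp only [perpPresentation, AlgHom.comp_apply, MvPolynomial.aeval_X, symMap,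
      SymmetricAlgebra.lift_ι_apply, LinearMap.comp_apply, g, perpLift_perpGen, ψ,
      LinearMap.toSpanSingleton_apply, Algebra.smul_def, ← h1]
    rw [mul_right_comm, mul_inv_cancel₀ hs', one_mul]
  have h2 := congr($hcomp F)
  rw [AlgHom.comp_apply, AlgHom.comp_apply, hg, map_zero] at h2
  rw [← Ideal.algebraMap_residueField_eq_zero (I := P.asIdeal)]
  rw [h2]
  have := MvPolynomial.aeval_algebraMap_apply κ a F
  rw [MvPolynomial.aeval_eq_eval] at this
  exact this.symm

end Rees

open IsLocalRing in
/-- `ℓ(N^⊥) = n` if the equations of the Rees algebra of `N^⊥` have coefficients in the maximal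
ideal. -/
theorem analyticSpread_perp_eq {R : Type u} {N : Type v} [CommRing R] [IsLocalRing R]
    [AddCommGroup N] [Module R N] {n : ℕ} {x : Fin n → N}
    (h : ∀ F, perpPresentation x F ∈ reesIdeal R (Perp R x) →
      MvPolynomial.map (residue R) F = 0) :
    analyticSpread R (Perp R x) = (n : WithBot ℕ∞) := by
  let q : MvPolynomial (Fin n) R →ₐ[R] ReesAlgebra R (Perp R x) :=
    (Ideal.Quotient.mkₐ R _).comp (perpPresentation x)
  have hq : Function.Surjective q :=
    (Ideal.Quotient.mkₐ_surjective R _).comp (perpPresentation_surjective x)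
  let τ : MvPolynomial (Fin n) R →ₐ[R] MvPolynomial (Fin n) (ResidueField R) :=
    MvPolynomial.mapAlgHom (Algebra.ofId R (ResidueField R))
  have hτ (F) : τ F = MvPolynomial.map (residue R) F := rfl
  have hτs : Function.Surjective τ := MvPolynomial.map_surjective _ residue_surjective
  have hle (F) (hF : q F = 0) : τ F = 0 := h F (Ideal.Quotient.eq_zero_iff_mem.1 hF)
  let σ : ReesAlgebra R (Perp R x) →ₐ[R] MvPolynomial (Fin n) (ResidueField R) :=
    (Ideal.Quotient.liftₐ (RingHom.ker q) τ hle).comp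
      (Ideal.quotientKerAlgEquivOfSurjective hq).symm.toAlgHom
  have hσ (F) : σ (q F) = τ F := by
    have : (Ideal.quotientKerAlgEquivOfSurjective hq).symm (q F) =
        Ideal.Quotient.mk (RingHom.ker q) F := by
      rw [AlgEquiv.symm_apply_eq]; rfl
    simp only [σ, AlgHom.comp_apply]
    exact congr(Ideal.Quotient.liftₐ (RingHom.ker q) τ hle $this)
  let Φ : MvPolynomial (Fin n) R →ₐ[R] ResidueField R ⊗[R] ReesAlgebra R (Perp R x) :=
    Algebra.TensorProduct.includeRight.comp q
  have hΦs : Function.Surjective Φ := by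
    intro z
    induction z using TensorProduct.induction_on with
    | zero => exact ⟨0, map_zero _⟩
    | add y z hy hz =>
      obtain ⟨F, rfl⟩ := hy
      obtain ⟨G, rfl⟩ := hz
      exact ⟨F + G, map_add _ _ _⟩
    | tmul c y =>
      obtain ⟨r, rfl⟩ := residue_surjective c
      obtain ⟨F, rfl⟩ := hq y
      refine ⟨r • F, ?_⟩
      simp only [Φ, AlgHom.comp_apply, map_smul, Algebra.TensorProduct.includeRight_apply]
      rw [TensorProduct.smul_tmul', Algebra.smul_def, mul_one]
      rfl
  let ω : ResidueField R ⊗[R] ReesAlgebra R (Perp R x) →ₐ[R]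
      MvPolynomial (Fin n) (ResidueField R) :=
    Algebra.TensorProduct.productMap (IsScalarTower.toAlgHom R (ResidueField R) _) σ
  have hω (F) : ω (Φ F) = τ F := by
    simp [ω, Φ, hσ]
  -- Both kernels are the extension of the maximal ideal: `Φ` kills it, and `τ` factors through `Φ`.
  have hinj : RingHom.ker Φ = RingHom.ker τ := by
    ext F
    rw [RingHom.mem_ker, RingHom.mem_ker]
    refine ⟨fun hF ↦ by rw [← hω, hF, map_zero], fun hF ↦ ?_⟩
    have hF' : F ∈ (maximalIdeal R).map MvPolynomial.C := by
      rw [MvPolynomial.mem_map_C_iff]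
      intro m
      have := congr(MvPolynomial.coeff m $hF)
      rwa [hτ, MvPolynomial.coeff_map, MvPolynomial.coeff_zero, residue_eq_zero_iff] at this
    have hker : (maximalIdeal R).map MvPolynomial.C ≤ RingHom.ker Φ := by
      rw [Ideal.map_le_iff_le_comap]
      intro r hr
      rw [Ideal.mem_comap, RingHom.mem_ker]
      have : Φ (MvPolynomial.C r) = algebraMap R _ r := Φ.commutes r
      rw [this, Algebra.TensorProduct.algebraMap_apply, ResidueField.algebraMap_eq,
        (residue_eq_zero_iff r).2 hr, TensorProduct.zero_tmul]
    exact hker hF'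
  let e := (Ideal.quotientKerAlgEquivOfSurjective hΦs).symm.trans
    ((Ideal.quotientEquivAlgOfEq R hinj).trans (Ideal.quotientKerAlgEquivOfSurjective hτs))
  rw [analyticSpread, ringKrullDim_eq_of_ringEquiv e.toRingEquiv,
    MvPolynomial.ringKrullDim_of_isNoetherianRing]
  simp

theorem analyticSpread_perp_eq_of_largeFreeSummands {R : Type u} {N : Type v} [CommRing R]
    [IsNoetherianRing R] [IsLocalRing R] [Infinite (IsLocalRing.ResidueField R)]
    [AddCommGroup N] [Module R N] [Module.Finite R N] {n : ℕ} {x : Fin n → N}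
    (hx : Submodule.span R (Set.range x) = ⊤) {r : ℕ} (hN : LargeFreeSummands R N r)
    (hr : ∀ y : N, (orderIdeal R y).height ≤ (r : ℕ∞)) :
    analyticSpread R (Perp R x) = (n : WithBot ℕ∞) := by
  have : Module.FinitePresentation R N := Module.finitePresentation_of_finite R N
  refine analyticSpread_perp_eq fun F hF ↦ ?_
  by_contra hne
  obtain ⟨J, hJ⟩ := (PrimeSpectrum.isClosed_iff_zeroLocus_ideal _).1
    (Module.isOpen_freeLocus (R := R) (M := N)).isClosed_compl
  have hJ' (P : PrimeSpectrum R) : J ≤ P.asIdeal ↔ P ∉ Module.freeLocus R N := by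
    rw [← Set.mem_compl_iff, hJ]; rfl
  let L : Set (MvPolynomial (Fin n) R) :=
    Set.range fun f : Module.Dual R N ↦ ∑ i, MvPolynomial.C (f (x i)) * MvPolynomial.X i
  let I := J.map MvPolynomial.C ⊔ Ideal.span L
  have hI : ((r + 1 : ℕ) : ℕ∞) ≤ I.height := by
    rw [Ideal.le_height_iff_forall_isPrime]
    intro Q hQ hIQ
    let P : PrimeSpectrum R := ⟨Q.comap MvPolynomial.C, inferInstance⟩
    have hP := hN P ((hJ' P).1 (Ideal.map_le_iff_le_comap.1 (le_sup_left.trans hIQ)))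
    obtain ⟨f, hf⟩ := exists_dual_linearIndependent_rf P hx
    have h1 := MvPolynomial.height_add_le_height P.asIdeal (Q := Q) rfl (fun j i ↦ f j (x i))
      (fun j ↦ hIQ (Ideal.mem_sup_right (Ideal.subset_span ⟨f j, rfl⟩))) hf
    rw [localDim_eq_height] at hP
    refine le_trans ?_ h1
    rw [add_comm P.asIdeal.height]
    exact_mod_cast hP
  obtain ⟨a, haF, ha⟩ := MvPolynomial.exists_eval_isUnit_and_le_height n I hI F hne
  have hle : ((r + 1 : ℕ) : ℕ∞) ≤ (orderIdeal R (∑ i, a i • x i)).height := by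
    rw [Ideal.le_height_iff_forall_isPrime]
    intro P hP haP
    -- At a free prime the unit `F(a)` would lie in `P`; at a nonfree one, `P` contains all of
    -- `I(a)`.
    by_cases hfree : (⟨P, hP⟩ : PrimeSpectrum R) ∈ Module.freeLocus R N
    · exact absurd (P.eq_top_of_isUnit_mem (eval_mem_of_mem_reesIdeal hx hF hfree haP) haF)
        hP.ne_top
    · refine ha.trans (Ideal.height_mono ?_)
      rw [Ideal.map_le_iff_le_comap, sup_le_iff, Ideal.map_le_iff_le_comap, Ideal.span_le]
      refine ⟨fun c hc ↦ ?_, ?_⟩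
      · rw [Ideal.mem_comap, Ideal.mem_comap, MvPolynomial.eval_C]
        exact (hJ' ⟨P, hP⟩).2 hfree hc
      · rintro _ ⟨f, rfl⟩
        rw [SetLike.mem_coe, Ideal.mem_comap]
        refine haP ⟨f, ?_⟩
        simp [mul_comm]
  have := hle.trans (hr _)
  rw [Nat.cast_le] at this
  omega

end OrderIdeals

theorem proposition3p9 {R : Type u} {N : Type v} [CommRing R] [IsNoetherianRing R]
    [IsLocalRing R] [Infinite (IsLocalRing.ResidueField R)]
    [AddCommGroup N] [Module R N] [Module.Finite R N]
    (x : Fin (OrderIdeals.minGens R N) → N) (hx : Submodule.span R (Set.range x) = ⊤) (r : ℕ) :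
    (OrderIdeals.LargeFreeSummands R N r →
      (∀ y : N, (OrderIdeals.orderIdeal R y).height ≤ (r : ℕ∞)) →
      OrderIdeals.analyticSpread R (OrderIdeals.Perp R x) =
        (OrderIdeals.minGens R N : WithBot ℕ∞)) ∧
    (OrderIdeals.HasGenericRank R N r →
      OrderIdeals.SatisfiesGInfty R (OrderIdeals.Perp R x) →
      OrderIdeals.LargeFreeSummands R N r) ∧
    (OrderIdeals.HasGenericRank R N r →
      OrderIdeals.SatisfiesGInfty R (OrderIdeals.Perp R x) →
      (∀ y : N, (OrderIdeals.orderIdeal R y).height ≤ (r : ℕ∞)) →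
      OrderIdeals.analyticSpread R (OrderIdeals.Perp R x) =
        (OrderIdeals.minGens R N : WithBot ℕ∞)) := by
  refine ⟨fun hN hr ↦ OrderIdeals.analyticSpread_perp_eq_of_largeFreeSummands hx hN hr,
    fun hN hG ↦ OrderIdeals.largeFreeSummands_of_satisfiesGInfty hx hN hG, fun hN hG hr ↦ ?_⟩
  exact OrderIdeals.analyticSpread_perp_eq_of_largeFreeSummands hx
    (OrderIdeals.largeFreeSummands_of_satisfiesGInfty hx hN hG) hr
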